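/- Let $K$ be a finite group acting from the left by automorphisms on a finite abelian group $A$, written ${}^k a$, and let $F\in Z^2(K,A)$ be a normalized 2-cocycle, i.e. ${}^{k_1}F(k_2,k_3)\,F(k_1k_2,k_3)^{-1}F(k_1,k_2k_3)\,F(k_1,k_2)^{-1}=1$. Let $G=A\rtimes_F K$ be the set $A\times K$ with product $(a_1,k_1)(a_2,k_2)=(a_1\,{}^{k_1}a_2\,F(k_1,k_2),\,k_1k_2)$. All cochains below are normalized (equal to $1$ whenever some group argument $k_i$ or $g_i$ is $1$). Put $\mathbb A=\mathrm{Hom}(A,\mathbb C^*)$ with the right $K$-action $\rho^k(a)=\rho({}^k a)$. *The double complex.* $G$ acts on $\mathrm{Map}(K,\mathbb C^*)$ by $(g\triangleright f)(x)=f(x\triangleleft g)$, where $x\triangleleft(a,k)=xk$. Let $C^q(G,\mathrm{Map}(K,\mathbb C^*))$ be the group of $q$-cochains $f(x;g_1,\dots,g_q)$, with differential $$(\delta_Gf)(x;g_1,\dots,g_{q+1})=f(x\triangleleft g_1;g_2,\dots,g_{q+1})\prod_{i=1}^{q}f(x;\dots,g_ig_{i+1},\dots)^{(-1)^i}\,f(x;g_1,\dots,g_q)^{(-1)^{q+1}}$$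 and right $K$-action $(f\triangleleft k)(x;g_1,\dots,g_q)=f(kx;g_1,\dots,g_q)$. Let $C^{p,q}=C^p(K,C^q(G,\mathrm{Map}(K,\mathbb C^*)))$. For a right $K$-module $M$, the differential of $C^*(K,M)$ is $$(\delta_Kf)(k_1,\dots,k_{p+1})=f(k_2,\dots,k_{p+1})\prod_{i=1}^{p}f(\dots,k_ik_{i+1},\dots)^{(-1)^i}\,\bigl(f(k_1,\dots,k_p)\triangleleft k_{p+1}\bigr)^{(-1)^{p+1}}.$$ This is applied to $M=C^q(G,\mathrm{Map}(K,\mathbb C^*))$, to $M=\mathbb A$, and to $M=\mathbb C^*$ with trivial action. The total complex $\mathrm{Tot}^n=\bigoplus_{p+q=n}C^{p,q}$ has differential $\delta_{Tot}=\delta_K\oplus(\delta_G)^{(-1)^p}$. The map $\omega\mapsto\pi^*\omega\in C^{0,n}$, $\pi^*\omega(x;g_1,\dots,g_n)=\omega(g_1,\dots,g_n)$, induces the canonical map $\pi^*:H^n(G,\mathbb C^*)\to H^n(\mathrm{Tot})$ (an isomorphism). *The group $\Omega(G;A)$.* Filter $\mathrm{Tot}$ by the degree $p$ of the $K$-cochains;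 the resulting spectral sequence is the Lyndon–Hochschild–Serre spectral sequence of $1\to A\to G\to K\to1$. Let $Z_\infty^{p,q}$ and $B_\infty^{p,q}$ be the groups of total $(p+q)$-cocycles, respectively $(p+q)$-coboundaries, lying in filtration degree at least $p$, so that $E_\infty^{p,q}=Z_\infty^{p,q}/(Z_\infty^{p+1,q-1}B_\infty^{p,q})$. Define $$\Omega(G;A)=\ker\Bigl(\ker\bigl(H^3(G,\mathbb C^*)\to E_\infty^{0,3}\bigr)\to E_\infty^{1,2}\Bigr)\subseteq H^3(G,\mathbb C^*),$$ where both maps are obtained by applying $\pi^*$ and taking the class in $E_\infty^{p,3-p}$ of a representing total cocycle of filtration at least $p$, for $p=0$ and $p=1$ respectively. **Proposition.** For every class $[\omega]\in\Omega(G;A)$ there exist $\widehat F\in Z^2(K,\mathbb A)$ and $\epsilon'\in C^3(K,\mathbb C^*)$ with $$\delta_K\epsilon'=\widehat F\wedge F,\qquad (\widehat F\wedge F)(k_1,k_2,k_3,k_4):=\widehat F(k_1,k_2)\bigl(F(k_3,k_4)\bigr),$$ such that, with $\varphi(\widehat F)\in C^{2,1}$ and $\beta\in C^{2,0}$ given by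 $$\varphi(\widehat F)(k_1,k_2)(x;(a,y))=\widehat F(k_1,k_2)\bigl({}^{x}a\,F(x,y)\bigr),\qquad \beta(k_1,k_2)(x)=\epsilon'(k_1,k_2,x),$$ the element $\varphi(\widehat F)\cdot\delta_G\beta\in C^{2,1}$ is a 3-cocycle of $\mathrm{Tot}$ and represents $[\omega]$, i.e. $\pi^*[\omega]=[\varphi(\widehat F)\cdot\delta_G\beta]$ in $H^3(\mathrm{Tot})$. -/

import Mathlib

namespace LHS

open scoped BigOperators

/-! ### Normalized group cochains (multiplicative notation) -/

/-- `C^n(Γ, M)`: functions `Γⁿ → M` equal to `1` as soon as one argument is `1`. -/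
def Cochain (Γ M : Type*) [Group Γ] [CommGroup M] (n : ℕ) : Subgroup ((Fin n → Γ) → M) where
  carrier := {f | ∀ g : Fin n → Γ, (∃ i, g i = 1) → f g = 1}
  mul_mem' := by
    intro a b ha hb g hg
    simp [ha g hg, hb g hg]
  one_mem' := by
    intro g _
    rfl
  inv_mem' := by
    intro a ha g hg
    simp [ha g hg]

/-- `∏_{i=1}^{n} f(g₁, …, gᵢgᵢ₊₁, …, gₙ₊₁)^{(-1)^i}`. -/
def innerFaces {Γ M : Type*} [Group Γ] [CommGroup M] {n : ℕ}
    (f : (Fin n → Γ) → M) (g : Fin (n + 1) → Γ) : M :=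
  ∏ j : Fin n, f (Fin.contractNth j.castSucc (· * ·) g) ^ ((-1 : ℤ) ^ ((j : ℕ) + 1))

theorem faces_eq_one {Γ M : Type*} [Group Γ] [CommGroup M] {n : ℕ}
    {f : (Fin n → Γ) → M} (hf : f ∈ Cochain Γ M n) (g : Fin (n + 1) → Γ)
    (hg : ∃ i, g i = 1) :
    f (Fin.tail g) * innerFaces f g * f (Fin.init g) ^ ((-1 : ℤ) ^ (n + 1)) = 1 := by
  have hlast : Fin.contractNth (Fin.last n) (· * ·) g = Fin.init g := by
    funext k
    simp [Fin.contractNth, Fin.init]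
  have hprod : innerFaces f g * f (Fin.init g) ^ ((-1 : ℤ) ^ (n + 1)) =
      ∏ j : Fin (n + 1), f (Fin.contractNth j (· * ·) g) ^ ((-1 : ℤ) ^ ((j : ℕ) + 1)) := by
    rw [Fin.prod_univ_castSucc, hlast]
    rfl
  rw [mul_assoc, hprod]
  obtain ⟨i, hi⟩ := hg
  refine Fin.cases (motive := fun i => g i = 1 → _) ?_ ?_ i hi
  · intro h0
    rw [Finset.prod_eq_single (0 : Fin (n + 1))]
    · have : Fin.contractNth (0 : Fin (n + 1)) (· * ·) g = Fin.tail g := by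
        funext k
        by_cases hk : (k : ℕ) = 0
        · have : k.castSucc = 0 := by ext; simpa using hk
          simp [Fin.contractNth, Fin.tail, hk, this, h0]
        · simp [Fin.contractNth, Fin.tail, hk]
      rw [this]
      simp
    · intro j _ hj
      have hj0 : 0 < (j : ℕ) := Nat.pos_of_ne_zero (fun h => hj (Fin.ext h))
      have hn : 0 < n := by have := j.2; omega
      rw [hf _ ⟨⟨0, hn⟩, ?_⟩, one_zpow]
      simpa [Fin.contractNth, hj0] using h0
    · simp
  · intro i' hi'
    rw [hf (Fin.tail g) ⟨i', hi'⟩, one_mul,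
      Finset.prod_eq_mul i'.castSucc i'.succ (by simp [Fin.ext_iff])]
    · have : Fin.contractNth i'.castSucc (· * ·) g = Fin.contractNth i'.succ (· * ·) g := by
        funext k
        rcases lt_trichotomy (k : ℕ) i' with h | h | h
        · have h2 : (k : ℕ) < i' + 1 := by omega
          simp [Fin.contractNth, h, h2]
        · have hk : k = i' := Fin.ext h
          subst hk
          simp [Fin.contractNth, hi']
        · have h1 : ¬ (k : ℕ) < i' := by omega
          have h2 : ¬ (k : ℕ) = i' := by omega
          have h3 : ¬ (k : ℕ) < i' + 1 := by omega
          by_cases h4 : (k : ℕ) = i' + 1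
          · have : k.castSucc = i'.succ := by ext; simpa using h4
            simp [Fin.contractNth, h4, this, hi']
          · simp [Fin.contractNth, h1, h2, h3, h4]
      rw [this]
      simp [pow_succ]
    · intro j _ hj
      have h1 : (j : ℕ) ≠ i' := fun h => hj.1 (Fin.ext h)
      have h2 : (j : ℕ) ≠ i' + 1 := fun h => hj.2 (Fin.ext h)
      by_cases hlt : (j : ℕ) < i'
      · have h3 : ¬ (i' : ℕ) < j := by omega
        rw [hf _ ⟨i', ?_⟩, one_zpow]
        simpa [Fin.contractNth, h3, h1.symm] using hi'
      · have h3 : (i' : ℕ) + 1 < j := by omega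
        have hn : (i' : ℕ) + 1 < n := by have := j.2; omega
        rw [hf _ ⟨⟨i' + 1, hn⟩, ?_⟩, one_zpow]
        have h5 : (⟨(i' : ℕ) + 1, hn⟩ : Fin n).castSucc = i'.succ := rfl
        simp only [Fin.contractNth, h3, if_true, h5, hi']
    · simp
    · simp

theorem mul_six {M : Type*} [CommGroup M] (a b c d e f : M) :
    a * b * (c * d) * (e * f) = a * c * e * (b * d * f) := by
  rw [mul_mul_mul_comm a b c d, mul_mul_mul_comm (a * c) (b * d) e f]

/-- The differential of `C^*(Γ, M)` for a left action `ρ` of `Γ` on `M`: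
`(δf)(g₁,…,gₙ₊₁) = ρ(g₁) f(g₂,…) · ∏ᵢ f(…,gᵢgᵢ₊₁,…)^{(-1)^i} · f(g₁,…,gₙ)^{(-1)^{n+1}}`. -/
def dLeft {Γ M : Type*} [Group Γ] [CommGroup M] (ρ : Γ →* Monoid.End M) (n : ℕ) :
    Cochain Γ M n →* Cochain Γ M (n + 1) where
  toFun f := ⟨fun g => ρ (g 0) (f.1 (Fin.tail g)) * innerFaces f.1 g *
      f.1 (Fin.init g) ^ ((-1 : ℤ) ^ (n + 1)), by
    intro g hg
    have h : ρ (g 0) (f.1 (Fin.tail g)) = f.1 (Fin.tail g) := by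
      obtain ⟨i, hi⟩ := hg
      refine Fin.cases (motive := fun i => g i = 1 → _) ?_ ?_ i hi
      · intro h0
        simp [h0]
      · intro j hj
        rw [f.2 (Fin.tail g) ⟨j, hj⟩, map_one]
    simpa only [h] using faces_eq_one f.2 g hg⟩
  map_one' := by
    ext g
    simp [innerFaces]
  map_mul' := by
    intro a b
    ext g
    simp only [innerFaces, Subgroup.coe_mul, Pi.mul_apply, map_mul, mul_zpow,
      Finset.prod_mul_distrib]
    exact mul_six _ _ _ _ _ _

/-- The differential of `C^*(Γ, M)` for a right action of `Γ` on `M`, given as a homomorphism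
`ρ` from the opposite group, `m ◁ k = ρ(op k) m`:
`(δf)(k₁,…,kₙ₊₁) = f(k₂,…) · ∏ᵢ f(…,kᵢkᵢ₊₁,…)^{(-1)^i} · (f(k₁,…,kₙ) ◁ kₙ₊₁)^{(-1)^{n+1}}`. -/
def dRight {Γ M : Type*} [Group Γ] [CommGroup M] (ρ : Γᵐᵒᵖ →* Monoid.End M) (n : ℕ) :
    Cochain Γ M n →* Cochain Γ M (n + 1) where
  toFun f := ⟨fun k => f.1 (Fin.tail k) * innerFaces f.1 k *
      ρ (MulOpposite.op (k (Fin.last n))) (f.1 (Fin.init k)) ^ ((-1 : ℤ) ^ (n + 1)), by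
    intro k hk
    have h : ρ (MulOpposite.op (k (Fin.last n))) (f.1 (Fin.init k)) = f.1 (Fin.init k) := by
      obtain ⟨i, hi⟩ := hk
      refine Fin.lastCases (motive := fun i => k i = 1 → _) ?_ ?_ i hi
      · intro h0
        simp [h0]
      · intro j hj
        rw [f.2 (Fin.init k) ⟨j, hj⟩, map_one]
    simpa only [h] using faces_eq_one f.2 k hk⟩
  map_one' := by
    ext g
    simp [innerFaces]
  map_mul' := by
    intro a b
    ext g
    simp only [innerFaces, Subgroup.coe_mul, Pi.mul_apply, map_mul, mul_zpow,
      Finset.prod_mul_distrib]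
    exact mul_six _ _ _ _ _ _

/-- Post-composition with a group homomorphism. -/
def Cochain.postcomp {Γ M N : Type*} [Group Γ] [CommGroup M] [CommGroup N] (φ : M →* N) (n : ℕ) :
    Cochain Γ M n →* Cochain Γ N n where
  toFun f := ⟨fun g => φ (f.1 g), fun g hg => (congrArg φ (f.2 g hg)).trans (map_one φ)⟩
  map_one' := by
    ext g
    simp
  map_mul' := by
    intro a b
    ext g
    simp

/-- `Z^n(Γ, M)` for a left action. -/
def leftCocycles {Γ M : Type*} [Group Γ] [CommGroup M] (ρ : Γ →* Monoid.End M) (n : ℕ) :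
    Subgroup (Cochain Γ M n) :=
  (dLeft ρ n).ker

/-- `B^n(Γ, M)` for a left action. -/
def leftCoboundaries {Γ M : Type*} [Group Γ] [CommGroup M] (ρ : Γ →* Monoid.End M) :
    (n : ℕ) → Subgroup (Cochain Γ M n)
  | 0 => ⊥
  | n + 1 => (dLeft ρ n).range

/-- `Z^n(Γ, M)` for a right action. -/
def rightCocycles {Γ M : Type*} [Group Γ] [CommGroup M] (ρ : Γᵐᵒᵖ →* Monoid.End M) (n : ℕ) :
    Subgroup (Cochain Γ M n) :=
  (dRight ρ n).ker

/-- `H^n(Γ, ℂˣ)`, with trivial action on `ℂˣ`. -/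
abbrev GroupH (Γ : Type*) [Group Γ] (n : ℕ) : Type _ :=
  leftCocycles (1 : Γ →* Monoid.End ℂˣ) n ⧸
    (leftCoboundaries (1 : Γ →* Monoid.End ℂˣ) n).subgroupOf
      (leftCocycles (1 : Γ →* Monoid.End ℂˣ) n)

/-! ### The extension `G = A ⋊_F K` -/

/-- `Z²(K, A)` for a left action of `K` on `A`. -/
abbrev ExtCocycle (K A : Type*) [Group K] [CommGroup A] [MulDistribMulAction K A] : Type _ :=
  leftCocycles (MulDistribMulAction.toMonoidEnd K A) 2

/-- The value `F(k₁,k₂)`. -/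
def ExtCocycle.val {K A : Type*} [Group K] [CommGroup A] [MulDistribMulAction K A]
    (F : ExtCocycle K A) (k₁ k₂ : K) : A :=
  F.1.1 ![k₁, k₂]

theorem ExtCocycle.one_left {K A : Type*} [Group K] [CommGroup A] [MulDistribMulAction K A]
    (F : ExtCocycle K A) (k : K) : F.val 1 k = 1 :=
  F.1.2 _ ⟨0, rfl⟩

theorem ExtCocycle.one_right {K A : Type*} [Group K] [CommGroup A] [MulDistribMulAction K A]
    (F : ExtCocycle K A) (k : K) : F.val k 1 = 1 :=
  F.1.2 _ ⟨1, rfl⟩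

theorem ExtCocycle.cocycle {K A : Type*} [Group K] [CommGroup A] [MulDistribMulAction K A]
    (F : ExtCocycle K A) (k₁ k₂ k₃ : K) :
    (k₁ • F.val k₂ k₃) * (F.val (k₁ * k₂) k₃)⁻¹ * F.val k₁ (k₂ * k₃) * (F.val k₁ k₂)⁻¹ = 1 := by
  have h : dLeft (MulDistribMulAction.toMonoidEnd K A) 2 F.1 = 1 := F.2
  have h2 := congrFun (congrArg Subtype.val h) ![k₁, k₂, k₃]
  have e0 : Fin.tail ![k₁, k₂, k₃] = ![k₂, k₃] := by
    funext i; fin_cases i <;> rfl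
  have e1 : Fin.contractNth 0 (· * ·) ![k₁, k₂, k₃] = ![k₁ * k₂, k₃] := by
    funext i; fin_cases i <;> rfl
  have e2 : Fin.contractNth 1 (· * ·) ![k₁, k₂, k₃] = ![k₁, k₂ * k₃] := by
    funext i; fin_cases i <;> rfl
  have e3 : Fin.init ![k₁, k₂, k₃] = ![k₁, k₂] := by
    funext i; fin_cases i <;> rfl
  have e (m : A) : MulDistribMulAction.toMonoidEnd K A k₁ m = k₁ • m := rfl
  simpa [-MulDistribMulAction.toMonoidEnd_apply, e, dLeft, innerFaces, Fin.prod_univ_two, e0, e1, e2, e3, ExtCocycle.val, mul_assoc] using h2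

/-- The underlying set `A × K` of `A ⋊_F K`. -/
@[ext] structure Ext {K A : Type*} [Group K] [CommGroup A] [MulDistribMulAction K A]
    (F : ExtCocycle K A) where
  left : A
  right : K

/-- `(a₁,k₁)(a₂,k₂) = (a₁ · ^{k₁}a₂ · F(k₁,k₂), k₁k₂)`. -/
instance Ext.instMul {K A : Type*} [Group K] [CommGroup A] [MulDistribMulAction K A]
    (F : ExtCocycle K A) : Mul (Ext F) :=
  ⟨fun x y => ⟨x.left * (x.right • y.left) * F.val x.right y.right, x.right * y.right⟩⟩

instance Ext.instOne {K A : Type*} [Group K] [CommGroup A] [MulDistribMulAction K A]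
    (F : ExtCocycle K A) : One (Ext F) :=
  ⟨⟨1, 1⟩⟩

instance Ext.instInv {K A : Type*} [Group K] [CommGroup A] [MulDistribMulAction K A]
    (F : ExtCocycle K A) : Inv (Ext F) :=
  ⟨fun x => ⟨(F.val x.right⁻¹ x.right)⁻¹ * (x.right⁻¹ • x.left)⁻¹, x.right⁻¹⟩⟩

instance Ext.instGroup {K A : Type*} [Group K] [CommGroup A] [MulDistribMulAction K A]
    (F : ExtCocycle K A) : Group (Ext F) :=
  Group.ofLeftAxioms
    (by
      intro x y z
      refine Ext.ext ?_ (mul_assoc _ _ _)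
      have h := F.cocycle x.right y.right z.right
      rw [mul_inv_eq_one] at h
      change x.left * (x.right • y.left) * F.val x.right y.right *
          ((x.right * y.right) • z.left) * F.val (x.right * y.right) z.right =
        x.left * (x.right • (y.left * (y.right • z.left) * F.val y.right z.right)) *
          F.val x.right (y.right * z.right)
      rw [← h]
      simp only [smul_mul', mul_smul, mul_assoc]
      congr 2
      generalize x.right • F.val y.right z.right = a
      generalize F.val (x.right * y.right) z.right = b
      generalize F.val x.right (y.right * z.right) = c
      generalize x.right • y.right • z.left = d
      rw [mul_comm d b, mul_left_comm c b d, inv_mul_cancel_left, mul_comm c d,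
        mul_left_comm a d c])
    (by
      intro x
      refine Ext.ext ?_ (one_mul _)
      change 1 * ((1 : K) • x.left) * F.val 1 x.right = x.left
      simp [F.one_left])
    (by
      intro x
      refine Ext.ext ?_ (inv_mul_cancel _)
      change (F.val x.right⁻¹ x.right)⁻¹ * (x.right⁻¹ • x.left)⁻¹ * (x.right⁻¹ • x.left) *
        F.val x.right⁻¹ x.right = 1
      simp)

/-- The projection `p : G → K`. -/
def Ext.proj {K A : Type*} [Group K] [CommGroup A] [MulDistribMulAction K A]
    (F : ExtCocycle K A) : Ext F →* K where
  toFun x := x.right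
  map_one' := rfl
  map_mul' _ _ := rfl

/-- The inclusion `A → G`. -/
def Ext.incl {K A : Type*} [Group K] [CommGroup A] [MulDistribMulAction K A]
    (F : ExtCocycle K A) : A →* Ext F where
  toFun a := ⟨a, 1⟩
  map_one' := rfl
  map_mul' a b := by
    refine Ext.ext ?_ (one_mul _).symm
    change a * b = a * ((1 : K) • b) * F.val 1 1
    simp [F.one_left]

/-- The section `u(k) = (1, k)`. -/
def Ext.sec {K A : Type*} [Group K] [CommGroup A] [MulDistribMulAction K A]
    (F : ExtCocycle K A) (k : K) : Ext F :=
  ⟨1, k⟩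

/-- The right action `k ◁ g = p(u(k)g)` of `G` on `K`. -/
def act {K A : Type*} [Group K] [CommGroup A] [MulDistribMulAction K A]
    (F : ExtCocycle K A) (k : K) (g : Ext F) : K :=
  Ext.proj F (Ext.sec F k * g)

theorem act_eq {K A : Type*} [Group K] [CommGroup A] [MulDistribMulAction K A]
    (F : ExtCocycle K A) (k : K) (g : Ext F) : act F k g = k * g.right :=
  rfl

/-- `κ_{k,(a,x)} = ^k a · F(k,x)`. -/
def kappa {K A : Type*} [Group K] [CommGroup A] [MulDistribMulAction K A]
    (F : ExtCocycle K A) (k : K) (g : Ext F) : A :=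
  (k • g.left) * F.val k g.right

/-- The defining property `u(k) g = κ_{k,g} u(k ◁ g)`. -/
theorem sec_mul {K A : Type*} [Group K] [CommGroup A] [MulDistribMulAction K A]
    (F : ExtCocycle K A) (k : K) (g : Ext F) :
    Ext.sec F k * g = Ext.incl F (kappa F k g) * Ext.sec F (act F k g) := by
  refine Ext.ext ?_ (one_mul _).symm
  change 1 * (k • g.left) * F.val k g.right =
    kappa F k g * ((1 : K) • (1 : A)) * F.val 1 (act F k g)
  simp [F.one_left, kappa]

theorem kappa_one {K A : Type*} [Group K] [CommGroup A] [MulDistribMulAction K A]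
    (F : ExtCocycle K A) (k : K) : kappa F k 1 = 1 := by
  change (k • (1 : A)) * F.val k 1 = 1
  simp [F.one_right]

/-! ### The double complex -/

/-- The left action `(g ▷ f)(k) = f(k ◁ g)` of `G` on `Map(K, ℂˣ)`. -/
def mapAction {K A : Type*} [Group K] [CommGroup A] [MulDistribMulAction K A]
    (F : ExtCocycle K A) : Ext F →* Monoid.End (K → ℂˣ) where
  toFun g :=
    { toFun := fun f k => f (act F k g)
      map_one' := rfl
      map_mul' := fun _ _ => rfl }
  map_one' := by
    refine MonoidHom.ext fun f => funext fun k => ?_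
    change f (k * 1) = f k
    rw [mul_one]
  map_mul' g h := by
    refine MonoidHom.ext fun f => funext fun k => ?_
    change f (k * (g.right * h.right)) = f (k * g.right * h.right)
    rw [mul_assoc]

theorem mapAction_apply {K A : Type*} [Group K] [CommGroup A] [MulDistribMulAction K A]
    (F : ExtCocycle K A) (g : Ext F) (f : K → ℂˣ) (k : K) :
    mapAction F g f k = f (k * g.right) :=
  rfl

/-- `C^q(G, Map(K, ℂˣ))`. -/
abbrev GCochain {K A : Type*} [Group K] [CommGroup A] [MulDistribMulAction K A]
    (F : ExtCocycle K A) (q : ℕ) : Type _ :=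
  Cochain (Ext F) (K → ℂˣ) q

/-- The right action `(f ◁ k)(x; g₁,…,g_q) = f(kx; g₁,…,g_q)` of `K` on
`C^q(G, Map(K, ℂˣ))`. -/
def translation {K A : Type*} [Group K] [CommGroup A] [MulDistribMulAction K A]
    (F : ExtCocycle K A) (q : ℕ) : Kᵐᵒᵖ →* Monoid.End (GCochain F q) where
  toFun k :=
    { toFun := fun f => ⟨fun g x => f.1 g (k.unop * x), fun g hg =>
        funext fun x => congrFun (f.2 g hg) (k.unop * x)⟩
      map_one' := rfl
      map_mul' := fun _ _ => rfl }
  map_one' := by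
    refine MonoidHom.ext fun f => Subtype.ext (funext fun g => funext fun x => ?_)
    change f.1 g (1 * x) = f.1 g x
    rw [one_mul]
  map_mul' k l := by
    refine MonoidHom.ext fun f => Subtype.ext (funext fun g => funext fun x => ?_)
    change f.1 g (l.unop * k.unop * x) = f.1 g (l.unop * (k.unop * x))
    rw [mul_assoc]

theorem translation_apply {K A : Type*} [Group K] [CommGroup A] [MulDistribMulAction K A]
    (F : ExtCocycle K A) (q : ℕ) (k : Kᵐᵒᵖ) (f : GCochain F q) (g : Fin q → Ext F) (x : K) :
    (translation F q k f).1 g x = f.1 g (k.unop * x) :=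
  rfl

/-- `C^{p,q} = C^p(K, C^q(G, Map(K, ℂˣ)))`; the value `f(k₁,…,k_p)(x; g₁,…,g_q)` is
`(f.1 k).1 g x`. -/
abbrev Bi {K A : Type*} [Group K] [CommGroup A] [MulDistribMulAction K A]
    (F : ExtCocycle K A) (p q : ℕ) : Type _ :=
  Cochain K (GCochain F q) p

/-- `δ_K : C^{p,q} → C^{p+1,q}`. -/
def deltaK {K A : Type*} [Group K] [CommGroup A] [MulDistribMulAction K A]
    (F : ExtCocycle K A) (p q : ℕ) : Bi F p q →* Bi F (p + 1) q :=
  dRight (translation F q) p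

/-- `δ_G : C^{p,q} → C^{p,q+1}`. -/
def deltaG {K A : Type*} [Group K] [CommGroup A] [MulDistribMulAction K A]
    (F : ExtCocycle K A) (p q : ℕ) : Bi F p q →* Bi F p (q + 1) :=
  Cochain.postcomp (dLeft (mapAction F) q) p

/-! ### The total complex, its cohomology and its filtration by `K`-degree -/

/-- The product of all `C^{p,q}`; `Tot^n` is the subgroup of families concentrated in
bidegrees with `p + q = n`. -/
def Families {K A : Type*} [Group K] [CommGroup A] [MulDistribMulAction K A]
    (F : ExtCocycle K A) : Type _ :=
  (p q : ℕ) → Bi F p q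

instance Families.instCommGroup {K A : Type*} [Group K] [CommGroup A] [MulDistribMulAction K A]
    (F : ExtCocycle K A) : CommGroup (Families F) :=
  inferInstanceAs (CommGroup ((p q : ℕ) → Bi F p q))

theorem Families.mul_apply {K A : Type*} [Group K] [CommGroup A] [MulDistribMulAction K A]
    {F : ExtCocycle K A} (x y : Families F) (p q : ℕ) : (x * y) p q = x p q * y p q :=
  rfl

theorem Families.one_apply {K A : Type*} [Group K] [CommGroup A] [MulDistribMulAction K A]
    {F : ExtCocycle K A} (p q : ℕ) : (1 : Families F) p q = 1 :=
  rfl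

theorem Families.inv_apply {K A : Type*} [Group K] [CommGroup A] [MulDistribMulAction K A]
    {F : ExtCocycle K A} (x : Families F) (p q : ℕ) : (x⁻¹) p q = (x p q)⁻¹ :=
  rfl

/-- `Tot^n`, i.e. the sum of the `C^{p,q}` with `p + q = n`. -/
def Tot {K A : Type*} [Group K] [CommGroup A] [MulDistribMulAction K A]
    (F : ExtCocycle K A) (n : ℕ) : Subgroup (Families F) where
  carrier := {x | ∀ p q, p + q ≠ n → x p q = 1}
  mul_mem' := by
    intro a b ha hb p q h
    rw [Families.mul_apply, ha p q h, hb p q h, one_mul]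
  one_mem' := by
    intro p q _
    rfl
  inv_mem' := by
    intro a ha p q h
    rw [Families.inv_apply, ha p q h, inv_one]

/-- An element of `C^{p,q}` as an element of the total complex. -/
def single {K A : Type*} [Group K] [CommGroup A] [MulDistribMulAction K A]
    (F : ExtCocycle K A) (p q : ℕ) (f : Bi F p q) : Families F :=
  (Pi.mulSingle p (Pi.mulSingle q f) : (i j : ℕ) → Bi F i j)

/-- The components of the total differential `δ_K ⊕ (δ_G)^{(-1)^p}`. -/
def deltaTotFun {K A : Type*} [Group K] [CommGroup A] [MulDistribMulAction K A]
    (F : ExtCocycle K A) (x : Families F) : Families F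
  | 0, 0 => 1
  | 0, q + 1 => deltaG F 0 q (x 0 q)
  | p + 1, 0 => deltaK F p 0 (x p 0)
  | p + 1, q + 1 =>
    deltaK F p (q + 1) (x p (q + 1)) * deltaG F (p + 1) q (x (p + 1) q) ^ ((-1 : ℤ) ^ (p + 1))

/-- The total differential. -/
def deltaTot {K A : Type*} [Group K] [CommGroup A] [MulDistribMulAction K A]
    (F : ExtCocycle K A) : Families F →* Families F where
  toFun := deltaTotFun F
  map_one' := by
    funext p q
    rcases p with _ | p <;> rcases q with _ | q
    · rfl
    · exact map_one (deltaG F 0 q)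
    · exact map_one (deltaK F p 0)
    · change deltaK F p (q + 1) 1 * deltaG F (p + 1) q 1 ^ ((-1 : ℤ) ^ (p + 1)) = 1
      rw [map_one, map_one, one_zpow, one_mul]
  map_mul' x y := by
    funext p q
    rcases p with _ | p <;> rcases q with _ | q
    · exact (mul_one (1 : Bi F 0 0)).symm
    · exact map_mul (deltaG F 0 q) (x 0 q) (y 0 q)
    · exact map_mul (deltaK F p 0) (x p 0) (y p 0)
    · change deltaK F p (q + 1) (x p (q + 1) * y p (q + 1)) *
          deltaG F (p + 1) q (x (p + 1) q * y (p + 1) q) ^ ((-1 : ℤ) ^ (p + 1)) =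
        (deltaK F p (q + 1) (x p (q + 1)) * deltaG F (p + 1) q (x (p + 1) q) ^ ((-1 : ℤ) ^ (p + 1)))
          * (deltaK F p (q + 1) (y p (q + 1)) *
            deltaG F (p + 1) q (y (p + 1) q) ^ ((-1 : ℤ) ^ (p + 1)))
      rw [map_mul, map_mul, mul_zpow, mul_mul_mul_comm]

/-- `Z^n(Tot)`. -/
def TotZ {K A : Type*} [Group K] [CommGroup A] [MulDistribMulAction K A]
    (F : ExtCocycle K A) (n : ℕ) : Subgroup (Families F) :=
  Tot F n ⊓ (deltaTot F).ker

/-- `B^n(Tot)`. -/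
def TotB {K A : Type*} [Group K] [CommGroup A] [MulDistribMulAction K A]
    (F : ExtCocycle K A) : ℕ → Subgroup (Families F)
  | 0 => ⊥
  | n + 1 => (Tot F n).map (deltaTot F)

/-- `H^n(Tot)`. -/
abbrev TotH {K A : Type*} [Group K] [CommGroup A] [MulDistribMulAction K A]
    (F : ExtCocycle K A) (n : ℕ) : Type _ :=
  TotZ F n ⧸ (TotB F n).subgroupOf (TotZ F n)

/-- The filtration by the degree of the `K`-cochains: families concentrated in `K`-degree
at least `p`. -/
def Fil {K A : Type*} [Group K] [CommGroup A] [MulDistribMulAction K A]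
    (F : ExtCocycle K A) (p : ℕ) : Subgroup (Families F) where
  carrier := {x | ∀ i j, i < p → x i j = 1}
  mul_mem' := by
    intro a b ha hb i j h
    rw [Families.mul_apply, ha i j h, hb i j h, one_mul]
  one_mem' := by
    intro i j _
    rfl
  inv_mem' := by
    intro a ha i j h
    rw [Families.inv_apply, ha i j h, inv_one]

/-- `Z_∞^{p,n-p}`: the total `n`-cocycles of filtration at least `p`. -/
def ZInf {K A : Type*} [Group K] [CommGroup A] [MulDistribMulAction K A]
    (F : ExtCocycle K A) (p n : ℕ) : Subgroup (Families F) :=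
  TotZ F n ⊓ Fil F p

/-- `B_∞^{p,n-p}`: the total `n`-coboundaries of filtration at least `p`. -/
def BInf {K A : Type*} [Group K] [CommGroup A] [MulDistribMulAction K A]
    (F : ExtCocycle K A) (p n : ℕ) : Subgroup (Families F) :=
  TotB F n ⊓ Fil F p

/-- `E_∞^{p,n-p} = Z_∞^{p,n-p} / (Z_∞^{p+1,n-p-1} · B_∞^{p,n-p})`, the infinity term of the
spectral sequence of the total complex filtered by `K`-degree. The index `n` is the total degree. -/
abbrev EInf {K A : Type*} [Group K] [CommGroup A] [MulDistribMulAction K A]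
    (F : ExtCocycle K A) (p n : ℕ) : Type _ :=
  ZInf F p n ⧸ (ZInf F (p + 1) n ⊔ BInf F p n).subgroupOf (ZInf F p n)

/-- The homomorphism `Z_∞^{p,n-p} → H^n(Tot)`. -/
def ZInf.toTotH {K A : Type*} [Group K] [CommGroup A] [MulDistribMulAction K A]
    (F : ExtCocycle K A) (p n : ℕ) : ZInf F p n →* TotH F n :=
  (QuotientGroup.mk' _).comp (Subgroup.inclusion inf_le_left)

/-- `F^p H^n(Tot)`: the classes represented by cocycles of filtration at least `p`. -/
def FilH {K A : Type*} [Group K] [CommGroup A] [MulDistribMulAction K A]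
    (F : ExtCocycle K A) (p n : ℕ) : Subgroup (TotH F n) :=
  (ZInf.toTotH F p n).range

theorem ker_toTotH_le {K A : Type*} [Group K] [CommGroup A] [MulDistribMulAction K A]
    (F : ExtCocycle K A) (p n : ℕ) :
    (ZInf.toTotH F p n).rangeRestrict.ker ≤
      (QuotientGroup.mk' ((ZInf F (p + 1) n ⊔ BInf F p n).subgroupOf (ZInf F p n))).ker := by
  intro z hz
  rw [MonoidHom.ker_rangeRestrict, MonoidHom.mem_ker] at hz
  rw [QuotientGroup.ker_mk', Subgroup.mem_subgroupOf]
  have h := (QuotientGroup.eq_one_iff _).1 hz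
  rw [Subgroup.mem_subgroupOf] at h
  exact Subgroup.mem_sup_right ⟨h, z.2.2⟩

/-- The canonical map `F^p H^n(Tot) → E_∞^{p,n-p}`, sending the class of a cocycle of filtration
at least `p` to the class of that cocycle. -/
noncomputable def toEInf {K A : Type*} [Group K] [CommGroup A] [MulDistribMulAction K A]
    (F : ExtCocycle K A) (p n : ℕ) : FilH F p n →* EInf F p n :=
  MonoidHom.liftOfSurjective (ZInf.toTotH F p n).rangeRestrict
    (MonoidHom.rangeRestrict_surjective _) ⟨QuotientGroup.mk' _, ker_toTotH_le F p n⟩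

theorem toEInf_apply {K A : Type*} [Group K] [CommGroup A] [MulDistribMulAction K A]
    (F : ExtCocycle K A) (p n : ℕ) (z : ZInf F p n) :
    toEInf F p n ((ZInf.toTotH F p n).rangeRestrict z) = QuotientGroup.mk z :=
  MonoidHom.liftOfRightInverse_comp_apply _ _ _ _ z

theorem mem_FilH_zero {K A : Type*} [Group K] [CommGroup A] [MulDistribMulAction K A]
    (F : ExtCocycle K A) (n : ℕ) (c : TotH F n) : c ∈ FilH F 0 n := by
  obtain ⟨z, rfl⟩ := QuotientGroup.mk_surjective c
  exact ⟨⟨z.1, z.2, fun i j h => absurd h (Nat.not_lt_zero i)⟩, rfl⟩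

theorem mem_FilH_succ {K A : Type*} [Group K] [CommGroup A] [MulDistribMulAction K A]
    (F : ExtCocycle K A) (p n : ℕ) (c : FilH F p n) (hc : toEInf F p n c = 1) :
    c.1 ∈ FilH F (p + 1) n := by
  obtain ⟨z, rfl⟩ := MonoidHom.rangeRestrict_surjective _ c
  rw [toEInf_apply, QuotientGroup.eq_one_iff, Subgroup.mem_subgroupOf, Subgroup.mem_sup] at hc
  obtain ⟨y, hy, b, hb, h⟩ := hc
  refine ⟨⟨y, hy⟩, ?_⟩
  refine QuotientGroup.eq.2 ?_
  rw [Subgroup.mem_subgroupOf]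
  change y⁻¹ * z.1 ∈ TotB F n
  rw [← h, inv_mul_cancel_left]
  exact hb.1

/-! ### The comparison map `π^* : H^n(G, ℂˣ) → H^n(Tot)` and the group `Ω(G; A)` -/

/-- `π^*ω(x; g₁,…,g_n) = ω(g₁,…,g_n)`, as an element of `C^{0,n}`. -/
def pullback {K A : Type*} [Group K] [CommGroup A] [MulDistribMulAction K A]
    (F : ExtCocycle K A) (n : ℕ) : Cochain (Ext F) ℂˣ n →* Bi F 0 n where
  toFun ω := ⟨fun _ => ⟨fun g _ => ω.1 g, fun g hg =>
    funext fun _ => ω.2 g hg⟩, fun _ hk => hk.elim fun i _ => i.elim0⟩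
  map_one' := rfl
  map_mul' _ _ := rfl

theorem single_same {K A : Type*} [Group K] [CommGroup A] [MulDistribMulAction K A]
    (F : ExtCocycle K A) (p q : ℕ) (f : Bi F p q) : single F p q f p q = f := by
  simp [single]

theorem single_ne {K A : Type*} [Group K] [CommGroup A] [MulDistribMulAction K A]
    (F : ExtCocycle K A) (p q : ℕ) (f : Bi F p q) (i j : ℕ) (h : i ≠ p ∨ j ≠ q) :
    single F p q f i j = 1 := by
  unfold single
  by_cases hi : i = p
  · subst hi
    rw [Pi.mulSingle_eq_same, Pi.mulSingle_eq_of_ne (by tauto)]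
  · rw [Pi.mulSingle_eq_of_ne hi, Pi.one_apply]

theorem single_mem_Tot {K A : Type*} [Group K] [CommGroup A] [MulDistribMulAction K A]
    (F : ExtCocycle K A) (p q n : ℕ) (h : p + q = n) (f : Bi F p q) :
    single F p q f ∈ Tot F n := by
  intro i j hij
  refine single_ne F p q f i j ?_
  by_contra hc
  push Not at hc
  omega

/-- The map `π^* : C^n(G, ℂˣ) → Tot`. -/
def toTot {K A : Type*} [Group K] [CommGroup A] [MulDistribMulAction K A]
    (F : ExtCocycle K A) (n : ℕ) : Cochain (Ext F) ℂˣ n →* Families F where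
  toFun ω := single F 0 n (pullback F n ω)
  map_one' := by
    rw [map_one]
    unfold single
    rw [Pi.mulSingle_one, Pi.mulSingle_one]
    rfl
  map_mul' a b := by
    rw [map_mul]
    unfold single
    rw [Pi.mulSingle_mul, Pi.mulSingle_mul]
    rfl

theorem deltaTot_toTot {K A : Type*} [Group K] [CommGroup A] [MulDistribMulAction K A]
    (F : ExtCocycle K A) (n : ℕ) (ω : Cochain (Ext F) ℂˣ n) :
    deltaTot F (toTot F n ω) = toTot F (n + 1) (dLeft 1 n ω) := by
  have hG : deltaG F 0 n (pullback F n ω) = pullback F (n + 1) (dLeft 1 n ω) := by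
    refine Subtype.ext (funext fun k => Subtype.ext (funext fun g => funext fun x => ?_))
    simp [deltaG, Cochain.postcomp, pullback, dLeft, innerFaces, mapAction_apply]
  have hK : deltaK F 0 n (pullback F n ω) = 1 := by
    refine Subtype.ext (funext fun k => Subtype.ext (funext fun g => funext fun x => ?_))
    simp [deltaK, pullback, dRight, innerFaces, translation_apply]
  have hs (p q : ℕ) (h : p ≠ 0 ∨ q ≠ n) : toTot F n ω p q = 1 := single_ne F 0 n _ p q h
  have hs2 (p q : ℕ) (h : p ≠ 0 ∨ q ≠ n + 1) : toTot F (n + 1) (dLeft 1 n ω) p q = 1 :=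
    single_ne F 0 (n + 1) _ p q h
  have hsame : toTot F n ω 0 n = pullback F n ω := single_same F 0 n _
  have hdK (q : ℕ) : deltaK F 0 q (toTot F n ω 0 q) = 1 := by
    by_cases hq : q = n
    · subst hq
      rw [hsame, hK]
    · rw [hs 0 q (Or.inr hq), map_one]
  funext p q
  rcases p with _ | p <;> rcases q with _ | q
  · exact (hs2 0 0 (Or.inr (by omega))).symm
  · change deltaG F 0 q (toTot F n ω 0 q) = _
    by_cases hq : q = n
    · subst hq
      rw [hsame, hG]
      exact (single_same F 0 (q + 1) _).symm
    · rw [hs 0 q (Or.inr hq), map_one, hs2 0 (q + 1) (Or.inr (by omega))]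
  · change deltaK F p 0 (toTot F n ω p 0) = _
    rw [hs2 (p + 1) 0 (Or.inl (by omega))]
    rcases p with _ | p
    · exact hdK 0
    · rw [hs (p + 1) 0 (Or.inl (by omega)), map_one]
  · change deltaK F p (q + 1) (toTot F n ω p (q + 1)) *
      deltaG F (p + 1) q (toTot F n ω (p + 1) q) ^ ((-1 : ℤ) ^ (p + 1)) = _
    rw [hs2 (p + 1) (q + 1) (Or.inl (by omega)), hs (p + 1) q (Or.inl (by omega)), map_one,
      one_zpow, mul_one]
    rcases p with _ | p
    · exact hdK (q + 1)
    · rw [hs (p + 1) (q + 1) (Or.inl (by omega)), map_one]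

theorem toTot_mem_TotZ {K A : Type*} [Group K] [CommGroup A] [MulDistribMulAction K A]
    (F : ExtCocycle K A) (n : ℕ) (ω : leftCocycles (1 : Ext F →* Monoid.End ℂˣ) n) :
    toTot F n ω.1 ∈ TotZ F n := by
  refine ⟨single_mem_Tot F 0 n n (zero_add n) _, ?_⟩
  change deltaTot F (toTot F n ω.1) = 1
  rw [deltaTot_toTot, MonoidHom.mem_ker.1 ω.2, map_one]

theorem toTot_mem_TotB {K A : Type*} [Group K] [CommGroup A] [MulDistribMulAction K A]
    (F : ExtCocycle K A) (n : ℕ) (ω : Cochain (Ext F) ℂˣ n)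
    (h : ω ∈ leftCoboundaries (1 : Ext F →* Monoid.End ℂˣ) n) : toTot F n ω ∈ TotB F n := by
  rcases n with _ | n
  · have h1 : ω = 1 := h
    rw [h1, map_one]
    exact one_mem _
  · obtain ⟨α, rfl⟩ := h
    exact ⟨toTot F n α, single_mem_Tot F 0 n n (zero_add n) _, deltaTot_toTot F n α⟩

/-- `π^*` on cocycles. -/
def toTotZ {K A : Type*} [Group K] [CommGroup A] [MulDistribMulAction K A]
    (F : ExtCocycle K A) (n : ℕ) :
    leftCocycles (1 : Ext F →* Monoid.End ℂˣ) n →* TotZ F n :=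
  ((toTot F n).comp (Subgroup.subtype _)).codRestrict (TotZ F n) (toTot_mem_TotZ F n)

/-- The canonical map `H^n(G, ℂˣ) → H^n(Tot)` induced by `π^*`. -/
def piStar {K A : Type*} [Group K] [CommGroup A] [MulDistribMulAction K A]
    (F : ExtCocycle K A) (n : ℕ) : GroupH (Ext F) n →* TotH F n :=
  QuotientGroup.map _ _ (toTotZ F n) fun ω h => toTot_mem_TotB F n ω.1 h

/-- `H³(G, ℂˣ) → E_∞^{0,3}`. -/
noncomputable def edgeZero {K A : Type*} [Group K] [CommGroup A] [MulDistribMulAction K A]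
    (F : ExtCocycle K A) : GroupH (Ext F) 3 →* EInf F 0 3 :=
  (toEInf F 0 3).comp ((piStar F 3).codRestrict (FilH F 0 3) fun _ => mem_FilH_zero F 3 _)

/-- `ker(H³(G, ℂˣ) → E_∞^{0,3}) → E_∞^{1,2}`. -/
noncomputable def edgeOne {K A : Type*} [Group K] [CommGroup A] [MulDistribMulAction K A]
    (F : ExtCocycle K A) : (edgeZero F).ker →* EInf F 1 3 :=
  (toEInf F 1 3).comp (((piStar F 3).comp (edgeZero F).ker.subtype).codRestrict (FilH F 1 3)
    fun c => mem_FilH_succ F 0 3 ⟨piStar F 3 c.1, mem_FilH_zero F 3 _⟩ c.2)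

/-- `Ω(G; A) = ker(ker(H³(G, ℂˣ) → E_∞^{0,3}) → E_∞^{1,2})`, as a subgroup of `H³(G, ℂˣ)`. -/
noncomputable def Omega {K A : Type*} [Group K] [CommGroup A] [MulDistribMulAction K A]
    (F : ExtCocycle K A) : Subgroup (GroupH (Ext F) 3) :=
  (edgeOne F).ker.map (edgeZero F).ker.subtype

/-! ### The representatives `φ(F̂) · δ_G β` -/

/-- The right action `ρ^k(a) = ρ(^k a)` of `K` on `Hom(A, ℂˣ)`. -/
def dualAction (K A : Type*) [Group K] [CommGroup A] [MulDistribMulAction K A] :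
    Kᵐᵒᵖ →* Monoid.End (A →* ℂˣ) where
  toFun k :=
    { toFun := fun ρ => ρ.comp (MulDistribMulAction.toMonoidHom A k.unop)
      map_one' := rfl
      map_mul' := fun _ _ => rfl }
  map_one' := by
    refine MonoidHom.ext fun ρ => MonoidHom.ext fun a => ?_
    change ρ ((1 : K) • a) = ρ a
    rw [one_smul]
  map_mul' k l := by
    refine MonoidHom.ext fun ρ => MonoidHom.ext fun a => ?_
    change ρ ((l.unop * k.unop) • a) = ρ (l.unop • k.unop • a)
    rw [mul_smul]

/-- `Z²(K, Hom(A, ℂˣ))`. -/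
abbrev DualCocycle (K A : Type*) [Group K] [CommGroup A] [MulDistribMulAction K A] : Type _ :=
  rightCocycles (dualAction K A) 2

/-- `(F̂ ∧ F)(k₁,k₂,k₃,k₄) = F̂(k₁,k₂)(F(k₃,k₄))`. -/
def wedge {K A : Type*} [Group K] [CommGroup A] [MulDistribMulAction K A]
    (Fhat : DualCocycle K A) (F : ExtCocycle K A) : Cochain K ℂˣ 4 :=
  ⟨fun k => Fhat.1.1 ![k 0, k 1] (F.val (k 2) (k 3)), by
    rintro k ⟨i, hi⟩
    fin_cases i
    · have h : Fhat.1.1 ![k 0, k 1] = 1 := Fhat.1.2 _ ⟨0, hi⟩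
      simp [h]
    · have h : Fhat.1.1 ![k 0, k 1] = 1 := Fhat.1.2 _ ⟨1, hi⟩
      simp [h]
    · have h : F.val (k 2) (k 3) = 1 := F.1.2 _ ⟨0, hi⟩
      simp [h]
    · have h : F.val (k 2) (k 3) = 1 := F.1.2 _ ⟨1, hi⟩
      simp [h]⟩

/-- `φ : Hom(A, ℂˣ) → C^1(G, Map(K, ℂˣ))`, `φ(ρ)(x; g) = ρ(κ_{x,g})`. -/
def varphi {K A : Type*} [Group K] [CommGroup A] [MulDistribMulAction K A]
    (F : ExtCocycle K A) : (A →* ℂˣ) →* GCochain F 1 where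
  toFun ρ := ⟨fun g x => ρ (kappa F x (g 0)), by
    rintro g ⟨i, hi⟩
    have h0 : g 0 = 1 := by rwa [Subsingleton.elim i 0] at hi
    funext x
    change ρ (kappa F x (g 0)) = 1
    rw [h0, kappa_one, map_one]⟩
  map_one' := rfl
  map_mul' _ _ := rfl

/-- `φ(F̂) ∈ C^{2,1}`. -/
def varphiHat {K A : Type*} [Group K] [CommGroup A] [MulDistribMulAction K A]
    (F : ExtCocycle K A) (Fhat : DualCocycle K A) : Bi F 2 1 :=
  Cochain.postcomp (varphi F) 2 Fhat.1

/-- `β(k₁,k₂)(x) = ε(k₁,k₂,x)`, an element of `C^{2,0}`. -/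
def beta {K A : Type*} [Group K] [CommGroup A] [MulDistribMulAction K A]
    (F : ExtCocycle K A) (ε : Cochain K ℂˣ 3) : Bi F 2 0 :=
  ⟨fun k => ⟨fun _ x => ε.1 ![k 0, k 1, x], fun _ hg => hg.elim fun i _ => i.elim0⟩, by
    rintro k ⟨i, hi⟩
    refine Subtype.ext (funext fun _ => funext fun x => ε.2 _ ?_)
    fin_cases i
    · exact ⟨0, hi⟩
    · exact ⟨1, hi⟩⟩

end LHS

/-!
Cochain groups are written additively here. A class in `Ω(G; A)` maps to a class of `H³(Tot)` of
filtration at least `2` (`piStar_mem_FilH_of_mem_Omega`), so it is represented by a pair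
`(γ, η) ∈ C^{2,1} × C^{3,0}` with `δ_G γ = 0`, `δ_K γ = δ_G η` and `δ_K η = 0`. The `K`-module
`Map(K, ℂˣ)` is coinduced, so `η = δ_K θ` for some `θ ∈ C^{2,0}`; subtracting `δ_Tot θ` leaves a
representative `γ ∈ C^{2,1}` killed by both differentials (`exists_single_of_mem_FilH`).

For fixed `k₁, k₂`, the cochain `γ(k₁, k₂)` is a `1`-cocycle of `G` with values in `Map(K, ℂˣ)`.
Shapiro's lemma in degree one can be made explicit: the cocycle identity along
`u(x) g = κ_{x,g} u(x ◁ g)`, where `u(x) = (1, x)`, gives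
`γ(k₁, k₂)(x; g) = F̂(k₁, k₂)(κ_{x,g}) + ε(k₁, k₂, x ◁ g) - ε(k₁, k₂, x)` with
`F̂(k₁, k₂)(a) = γ(k₁, k₂)(1; a)` and `ε(k₁, k₂, x) = γ(k₁, k₂)(1; u(x))`. This is
`γ = φ(F̂) + δ_G β` (`varphiHat_mul_deltaG_beta`). It remains to read off two special cases of
`δ_K γ = 0`: at `(1; a)` with `a ∈ A` it says `δ_K F̂ = 0`
(`characterCochain_mem_rightCocycles`), and at `(1; u(x))` it says `δ_K ε = F̂ ∧ F`
(`dRight_secCochain`).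
-/

namespace LHS

/-! ### Low-degree differentials -/

theorem dRight_two_apply {Γ M : Type*} [Group Γ] [CommGroup M] (ρ : Γᵐᵒᵖ →* Monoid.End M)
    (f : Cochain Γ M 2) (a b c : Γ) :
    (dRight ρ 2 f).1 ![a, b, c] =
      f.1 ![b, c] * (f.1 ![a * b, c])⁻¹ * f.1 ![a, b * c] *
        (ρ (MulOpposite.op c) (f.1 ![a, b]))⁻¹ := by
  have e0 : Fin.tail ![a, b, c] = ![b, c] := by funext i; fin_cases i <;> rfl
  have e1 : Fin.contractNth 0 (· * ·) ![a, b, c] = ![a * b, c] := by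
    funext i; fin_cases i <;> rfl
  have e2 : Fin.contractNth 1 (· * ·) ![a, b, c] = ![a, b * c] := by
    funext i; fin_cases i <;> rfl
  have e3 : Fin.init ![a, b, c] = ![a, b] := by funext i; fin_cases i <;> rfl
  simp [dRight, innerFaces, Fin.prod_univ_two, e0, e1, e2, e3, pow_succ, mul_assoc, mul_left_comm]

theorem dRight_three_apply {Γ M : Type*} [Group Γ] [CommGroup M] (ρ : Γᵐᵒᵖ →* Monoid.End M)
    (f : Cochain Γ M 3) (a b c d : Γ) :
    (dRight ρ 3 f).1 ![a, b, c, d] =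
      f.1 ![b, c, d] * (f.1 ![a * b, c, d])⁻¹ * f.1 ![a, b * c, d] * (f.1 ![a, b, c * d])⁻¹ *
        ρ (MulOpposite.op d) (f.1 ![a, b, c]) := by
  have e0 : Fin.tail ![a, b, c, d] = ![b, c, d] := by funext i; fin_cases i <;> rfl
  have e1 : Fin.contractNth 0 (· * ·) ![a, b, c, d] = ![a * b, c, d] := by
    funext i; fin_cases i <;> rfl
  have e2 : Fin.contractNth 1 (· * ·) ![a, b, c, d] = ![a, b * c, d] := by
    funext i; fin_cases i <;> rfl
  have e3 : Fin.contractNth 2 (· * ·) ![a, b, c, d] = ![a, b, c * d] := by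
    funext i; fin_cases i <;> rfl
  have e4 : Fin.init ![a, b, c, d] = ![a, b, c] := by funext i; fin_cases i <;> rfl
  simp [dRight, innerFaces, Fin.prod_univ_three, e0, e1, e2, e3, e4, pow_succ, mul_assoc,
    mul_left_comm]

theorem dLeft_zero_apply {Γ M : Type*} [Group Γ] [CommGroup M] (ρ : Γ →* Monoid.End M)
    (f : Cochain Γ M 0) (g : Γ) :
    (dLeft ρ 0 f).1 ![g] = ρ g (f.1 ![]) * (f.1 ![])⁻¹ := by
  have e0 : Fin.tail ![g] = ![] := Subsingleton.elim _ _
  have e1 : Fin.init ![g] = ![] := Subsingleton.elim _ _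
  simp [dLeft, innerFaces, e0, e1]

theorem dLeft_one_apply {Γ M : Type*} [Group Γ] [CommGroup M] (ρ : Γ →* Monoid.End M)
    (f : Cochain Γ M 1) (g h : Γ) :
    (dLeft ρ 1 f).1 ![g, h] = ρ g (f.1 ![h]) * (f.1 ![g * h])⁻¹ * f.1 ![g] := by
  have e0 : Fin.tail ![g, h] = ![h] := by funext i; fin_cases i; rfl
  have e1 : Fin.contractNth 0 (· * ·) ![g, h] = ![g * h] := by funext i; fin_cases i; rfl
  have e2 : Fin.init ![g, h] = ![g] := by funext i; fin_cases i; rfl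
  simp [dLeft, innerFaces, e0, e1, e2, pow_succ]

theorem Cochain.ext_one {Γ M : Type*} [Group Γ] [CommGroup M] {f f' : Cochain Γ M 1}
    (h : ∀ a, f.1 ![a] = f'.1 ![a]) : f = f' := by
  refine Subtype.ext (funext fun k => ?_)
  have e : k = ![k 0] := by funext i; fin_cases i; rfl
  rw [e]; exact h _

theorem Cochain.ext_two {Γ M : Type*} [Group Γ] [CommGroup M] {f f' : Cochain Γ M 2}
    (h : ∀ a b, f.1 ![a, b] = f'.1 ![a, b]) : f = f' := by
  refine Subtype.ext (funext fun k => ?_)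
  have e : k = ![k 0, k 1] := by funext i; fin_cases i <;> rfl
  rw [e]; exact h _ _

theorem Cochain.ext_three {Γ M : Type*} [Group Γ] [CommGroup M] {f f' : Cochain Γ M 3}
    (h : ∀ a b c, f.1 ![a, b, c] = f'.1 ![a, b, c]) : f = f' := by
  refine Subtype.ext (funext fun k => ?_)
  have e : k = ![k 0, k 1, k 2] := by funext i; fin_cases i <;> rfl
  rw [e]; exact h _ _ _

theorem Cochain.ext_four {Γ M : Type*} [Group Γ] [CommGroup M] {f f' : Cochain Γ M 4}
    (h : ∀ a b c d, f.1 ![a, b, c, d] = f'.1 ![a, b, c, d]) : f = f' := by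
  refine Subtype.ext (funext fun k => ?_)
  have e : k = ![k 0, k 1, k 2, k 3] := by funext i; fin_cases i <;> rfl
  rw [e]; exact h _ _ _ _

theorem dLeft_one_dLeft_zero {Γ M : Type*} [Group Γ] [CommGroup M] (ρ : Γ →* Monoid.End M)
    (f : Cochain Γ M 0) : dLeft ρ 1 (dLeft ρ 0 f) = 1 := by
  refine Cochain.ext_two fun g h => ?_
  rw [dLeft_one_apply, dLeft_zero_apply, dLeft_zero_apply, dLeft_zero_apply, map_mul, map_inv,
    map_mul]
  change ρ g (ρ h _) * _ * (ρ g (ρ h _) * _)⁻¹ * _ = 1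
  -- pass to additive notation, where `abel` applies
  apply Additive.ofMul.injective
  simp only [ofMul_mul, ofMul_inv, ofMul_one]
  abel

theorem dRight_postcomp {Γ M N : Type*} [Group Γ] [CommGroup M] [CommGroup N]
    (ρ : Γᵐᵒᵖ →* Monoid.End M) (σ : Γᵐᵒᵖ →* Monoid.End N) (φ : M →* N)
    (hφ : ∀ k m, φ (ρ k m) = σ k (φ m)) (n : ℕ) (f : Cochain Γ M n) :
    dRight σ n (Cochain.postcomp φ n f) = Cochain.postcomp φ (n + 1) (dRight ρ n f) := by
  refine Subtype.ext (funext fun k => ?_)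
  simp [dRight, Cochain.postcomp, innerFaces, hφ]

variable {K A : Type*} [Group K] [CommGroup A] [MulDistribMulAction K A]

/-! ### The total differential on homogeneous elements -/

theorem deltaG_deltaG_zero (F : ExtCocycle K A) (p : ℕ) (f : Bi F p 0) :
    deltaG F p 1 (deltaG F p 0 f) = 1 :=
  Subtype.ext (funext fun k => dLeft_one_dLeft_zero (mapAction F) (f.1 k))

theorem deltaK_deltaG (F : ExtCocycle K A) (p q : ℕ) (f : Bi F p q) :
    deltaK F p (q + 1) (deltaG F p q f) = deltaG F (p + 1) q (deltaK F p q f) := by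
  have h (k : Kᵐᵒᵖ) (m : GCochain F q) : dLeft (mapAction F) q (translation F q k m) =
      translation F (q + 1) k (dLeft (mapAction F) q m) := by
    refine Subtype.ext (funext fun g => funext fun x => ?_)
    simp [dLeft, innerFaces, translation_apply, mapAction_apply, mul_assoc]
  exact dRight_postcomp (M := GCochain F q) (N := GCochain F (q + 1)) _ _ _ h p f

theorem single_mul (F : ExtCocycle K A) (p q : ℕ) (f f' : Bi F p q) :
    single F p q (f * f') = single F p q f * single F p q f' := by
  unfold single
  rw [Pi.mulSingle_mul, Pi.mulSingle_mul]
  rfl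

theorem deltaTot_single (F : ExtCocycle K A) (p q : ℕ) (f : Bi F p q) :
    deltaTot F (single F p q f) =
      single F (p + 1) q (deltaK F p q f) *
        single F p (q + 1) (deltaG F p q f ^ ((-1 : ℤ) ^ p)) := by
  have hK (i j : ℕ) : deltaK F i j (single F p q f i j) =
      single F (p + 1) q (deltaK F p q f) (i + 1) j := by
    by_cases h : i = p ∧ j = q
    · obtain ⟨rfl, rfl⟩ := h
      rw [single_same, single_same]
    · rw [single_ne _ _ _ _ _ _ (by tauto), single_ne _ _ _ _ _ _ (by omega), map_one]
  have hG (i j : ℕ) : deltaG F i j (single F p q f i j) ^ ((-1 : ℤ) ^ i) =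
      single F p (q + 1) (deltaG F p q f ^ ((-1 : ℤ) ^ p)) i (j + 1) := by
    by_cases h : i = p ∧ j = q
    · obtain ⟨rfl, rfl⟩ := h
      rw [single_same, single_same]
    · rw [single_ne _ _ _ _ _ _ (by tauto), single_ne _ _ _ _ _ _ (by omega), map_one, one_zpow]
  funext i j
  rw [Families.mul_apply]
  rcases i with _ | i <;> rcases j with _ | j
  · rw [single_ne _ _ _ _ _ _ (by omega), single_ne _ _ _ _ _ _ (by omega), one_mul]
    rfl
  · rw [← hG, single_ne F (p + 1) _ _ _ _ (by omega), one_mul, pow_zero, zpow_one]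
    rfl
  · rw [← hK, single_ne F p (q + 1) _ _ _ (by omega), mul_one]
    rfl
  · rw [← hK, ← hG]
    rfl

/-- A total cocycle of degree `3` and filtration at least `2` is a pair `(γ, η)` in
`C^{2,1} × C^{3,0}` with `δ_G γ = 1`, `δ_K γ = δ_G η` and `δ_K η = 1`. -/
theorem ZInf_two_three (F : ExtCocycle K A) (z : ZInf F 2 3) :
    z.1 = single F 2 1 (z.1 2 1) * single F 3 0 (z.1 3 0) ∧
      deltaG F 2 1 (z.1 2 1) = 1 ∧
      deltaK F 2 1 (z.1 2 1) = deltaG F 3 0 (z.1 3 0) ∧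
      deltaK F 3 0 (z.1 3 0) = 1 := by
  obtain ⟨z, ⟨hT, hd⟩, hF⟩ := z
  have hd' : deltaTot F z = 1 := hd
  refine ⟨?_, ?_, ?_, ?_⟩
  · funext i j
    rw [Families.mul_apply]
    by_cases h : i = 2 ∧ j = 1
    · obtain ⟨rfl, rfl⟩ := h
      rw [single_same, single_ne _ _ _ _ _ _ (by omega), mul_one]
    by_cases h' : i = 3 ∧ j = 0
    · obtain ⟨rfl, rfl⟩ := h'
      rw [single_same, single_ne _ _ _ _ _ _ (by omega), one_mul]
    rw [single_ne _ _ _ _ _ _ (by omega), single_ne _ _ _ _ _ _ (by omega), one_mul]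
    by_cases hi : i < 2
    · exact hF i j hi
    · exact hT i j (by omega)
  · have h := congrFun (congrFun hd' 2) 2
    change deltaK F 1 2 (z 1 2) * deltaG F 2 1 (z 2 1) ^ ((-1 : ℤ) ^ 2) = 1 at h
    rw [hF 1 2 (by omega), map_one, one_mul] at h
    simpa using h
  · have h := congrFun (congrFun hd' 3) 1
    change deltaK F 2 1 (z 2 1) * deltaG F 3 0 (z 3 0) ^ ((-1 : ℤ) ^ 3) = 1 at h
    rw [show ((-1 : ℤ) ^ 3) = -1 by norm_num, zpow_neg_one] at h
    exact mul_inv_eq_one.1 h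
  · exact congrFun (congrFun hd' 4) 0

/-- The row `C^{*,0}` is exact in `K`-degree `3`: its coefficients are coinduced, and evaluating
the translation variable at `1` gives a contracting homotopy. -/
theorem exists_deltaK_two_zero_eq (F : ExtCocycle K A) (η : Bi F 3 0) (h : deltaK F 3 0 η = 1) :
    ∃ θ : Bi F 2 0, deltaK F 2 0 θ = η := by
  refine ⟨⟨fun k => ⟨fun g x => ((η.1 ![k 0, k 1, x]).1 g 1)⁻¹,
    fun _ hg => hg.elim fun i _ => i.elim0⟩, ?_⟩, ?_⟩
  · rintro k ⟨i, hi⟩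
    refine Subtype.ext (funext fun g => funext fun x => ?_)
    have h1 : η.1 ![k 0, k 1, x] = 1 := by
      refine η.2 _ ?_
      fin_cases i
      · exact ⟨0, hi⟩
      · exact ⟨1, hi⟩
    change ((η.1 ![k 0, k 1, x]).1 g 1)⁻¹ = 1
    rw [h1]
    exact inv_one
  · refine Cochain.ext_three fun a b c => Subtype.ext (funext fun g => funext fun x => ?_)
    -- the cocycle identity for `η` at `(a, b, c, x)`, evaluated at the unit of `K`
    have hη := congrFun (congrFun (congrArg Subtype.val
      (congrFun (congrArg Subtype.val h) ![a, b, c, x])) g) 1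
    have e := dRight_three_apply (translation F 0) η a b c x
    change ((deltaK F 3 0 η).1 ![a, b, c, x]).1 g 1 = 1 at hη
    unfold deltaK at hη ⊢
    rw [e] at hη
    rw [dRight_two_apply]
    change (η.1 ![b, c, x]).1 g 1 * ((η.1 ![a * b, c, x]).1 g 1)⁻¹ * (η.1 ![a, b * c, x]).1 g 1 *
      ((η.1 ![a, b, c * x]).1 g 1)⁻¹ * (η.1 ![a, b, c]).1 g (x * 1) = 1 at hη
    change ((η.1 ![b, c, x]).1 g 1)⁻¹ * (((η.1 ![a * b, c, x]).1 g 1)⁻¹)⁻¹ *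
      ((η.1 ![a, b * c, x]).1 g 1)⁻¹ * (((η.1 ![a, b, c * x]).1 g 1)⁻¹)⁻¹ =
      (η.1 ![a, b, c]).1 g x
    rw [mul_one] at hη
    have hη' := congrArg Additive.ofMul hη
    apply Additive.ofMul.injective
    simp only [ofMul_mul, ofMul_inv, ofMul_one] at hη' ⊢
    rw [← sub_eq_zero, ← neg_eq_zero, ← hη']
    abel

/-! ### One-cocycles with values in `Map(K, ℂˣ)` -/

/-- The cocycle identity for `γ ∈ Z¹(G, Map(K, ℂˣ))`. -/
theorem GCochain.map_mul_of_dLeft_eq_one {F : ExtCocycle K A} {γ : GCochain F 1}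
    (h : dLeft (mapAction F) 1 γ = 1) (g g' : Ext F) (x : K) :
    γ.1 ![g * g'] x = γ.1 ![g] x * γ.1 ![g'] (x * g.right) := by
  have h1 := congrFun (congrFun (congrArg Subtype.val h) ![g, g']) x
  rw [dLeft_one_apply] at h1
  change γ.1 ![g'] (x * g.right) * (γ.1 ![g * g'] x)⁻¹ * γ.1 ![g] x = 1 at h1
  rw [mul_right_comm, mul_inv_eq_one] at h1
  rw [← h1, mul_comm]

/-- The character `a ↦ γ(1; a)` of `A` defined by `γ ∈ Z¹(G, Map(K, ℂˣ))`. -/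
def GCochain.character {F : ExtCocycle K A} (γ : GCochain F 1)
    (h : dLeft (mapAction F) 1 γ = 1) : A →* ℂˣ where
  toFun a := γ.1 ![Ext.incl F a] 1
  map_one' := by
    rw [map_one, γ.2 ![1] ⟨0, rfl⟩]
    rfl
  map_mul' a b := by
    rw [map_mul, GCochain.map_mul_of_dLeft_eq_one h]
    change _ * γ.1 ![Ext.incl F b] (1 * 1) = _
    rw [one_mul]

/-- Shapiro's lemma in degree one, with an explicit coboundary: `γ` is the product of `φ(ρ)` and
`δ_G b`, where `ρ` is the character of `γ` and `b(x) = γ(1; u(x))`. -/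
theorem GCochain.apply_eq_character_mul {F : ExtCocycle K A} {γ : GCochain F 1}
    (h : dLeft (mapAction F) 1 γ = 1) (g : Ext F) (x : K) :
    γ.1 ![g] x = γ.character h (kappa F x g) *
      (γ.1 ![Ext.sec F (x * g.right)] 1 * (γ.1 ![Ext.sec F x] 1)⁻¹) := by
  have h1 := GCochain.map_mul_of_dLeft_eq_one h (Ext.sec F x) g 1
  have h2 := GCochain.map_mul_of_dLeft_eq_one h (Ext.incl F (kappa F x g))
    (Ext.sec F (act F x g)) 1
  rw [sec_mul, h2] at h1
  change γ.1 ![Ext.incl F (kappa F x g)] 1 * γ.1 ![Ext.sec F (x * g.right)] (1 * 1) =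
    γ.1 ![Ext.sec F x] 1 * γ.1 ![g] (1 * x) at h1
  rw [one_mul, one_mul] at h1
  rw [← mul_assoc, eq_mul_inv_iff_mul_eq, mul_comm]
  exact h1.symm

/-! ### Cocycles concentrated in bidegree `(2, 1)` -/

theorem dLeft_apply_eq_one {F : ExtCocycle K A} {γ : Bi F 2 1} (hG : deltaG F 2 1 γ = 1)
    (k : Fin 2 → K) : dLeft (mapAction F) 1 (γ.1 k) = 1 :=
  congrFun (congrArg Subtype.val hG) k

/-- The `2`-cochain of characters `F̂(k₁, k₂)(a) = γ(k₁, k₂)(1; a)`. -/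
def characterCochain {F : ExtCocycle K A} (γ : Bi F 2 1) (hG : deltaG F 2 1 γ = 1) :
    Cochain K (A →* ℂˣ) 2 :=
  ⟨fun k => (γ.1 k).character (dLeft_apply_eq_one hG k), fun k hk => by
    refine MonoidHom.ext fun a => ?_
    change (γ.1 k).1 ![Ext.incl F a] 1 = 1
    rw [γ.2 k hk]
    rfl⟩

/-- The `3`-cochain `ε(k₁, k₂, x) = γ(k₁, k₂)(1; u(x))`. -/
def secCochain {F : ExtCocycle K A} (γ : Bi F 2 1) : Cochain K ℂˣ 3 :=
  ⟨fun k => (γ.1 ![k 0, k 1]).1 ![Ext.sec F (k 2)] 1, by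
    have h (k : Fin 3 → K) (hk : ∃ i, ![k 0, k 1] i = 1) :
        (γ.1 ![k 0, k 1]).1 ![Ext.sec F (k 2)] 1 = 1 := by
      rw [γ.2 _ hk]
      rfl
    rintro k ⟨i, hi⟩
    fin_cases i
    · exact h k ⟨0, hi⟩
    · exact h k ⟨1, hi⟩
    · exact congrFun ((γ.1 ![k 0, k 1]).2 ![Ext.sec F (k 2)]
        ⟨0, congrArg (Ext.mk (F := F) 1) hi⟩) 1⟩

theorem apply_eq_characterCochain_mul {F : ExtCocycle K A} (γ : Bi F 2 1)
    (hG : deltaG F 2 1 γ = 1) (a b x : K) (g : Ext F) :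
    (γ.1 ![a, b]).1 ![g] x = (characterCochain γ hG).1 ![a, b] (kappa F x g) *
      ((secCochain γ).1 ![a, b, x * g.right] * ((secCochain γ).1 ![a, b, x])⁻¹) :=
  GCochain.apply_eq_character_mul (dLeft_apply_eq_one hG ![a, b]) g x

theorem deltaK_two_one_apply {F : ExtCocycle K A} {γ : Bi F 2 1} (hK : deltaK F 2 1 γ = 1)
    (a b c : K) (g : Ext F) (x : K) :
    (γ.1 ![b, c]).1 ![g] x * ((γ.1 ![a * b, c]).1 ![g] x)⁻¹ * (γ.1 ![a, b * c]).1 ![g] x *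
      ((γ.1 ![a, b]).1 ![g] (c * x))⁻¹ = 1 := by
  have h := congrFun (congrFun (congrArg Subtype.val
    (congrFun (congrArg Subtype.val hK) ![a, b, c])) ![g]) x
  unfold deltaK at h
  rw [dRight_two_apply] at h
  exact h

/-- `δ_K γ = 1` evaluated at `(1; a)` with `a ∈ A` says that `F̂` is a cocycle. -/
theorem characterCochain_mem_rightCocycles {F : ExtCocycle K A} (γ : Bi F 2 1)
    (hG : deltaG F 2 1 γ = 1) (hK : deltaK F 2 1 γ = 1) :
    characterCochain γ hG ∈ rightCocycles (dualAction K A) 2 := by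
  refine MonoidHom.mem_ker.2 (Cochain.ext_three fun a b c => MonoidHom.ext fun n => ?_)
  have h := deltaK_two_one_apply hK a b c (Ext.incl F n) 1
  have hκ : kappa F c (Ext.incl F n) = c • n := by
    change c • n * F.val c 1 = c • n
    rw [F.one_right, mul_one]
  have hr : c * (Ext.incl F n).right = c := mul_one c
  rw [mul_one, apply_eq_characterCochain_mul γ hG a b c, hκ, hr, mul_inv_cancel, mul_one] at h
  rw [dRight_two_apply]
  exact h

/-- `δ_K γ = 1` evaluated at `(1; u(x))` says that `δ_K ε = F̂ ∧ F`. -/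
theorem dRight_secCochain {F : ExtCocycle K A} (γ : Bi F 2 1)
    (hG : deltaG F 2 1 γ = 1) (hK : deltaK F 2 1 γ = 1) :
    dRight (1 : Kᵐᵒᵖ →* Monoid.End ℂˣ) 3 (secCochain γ) =
      wedge ⟨characterCochain γ hG, characterCochain_mem_rightCocycles γ hG hK⟩ F := by
  refine Cochain.ext_four fun a b c d => ?_
  have h := deltaK_two_one_apply hK a b c (Ext.sec F d) 1
  have hκ : kappa F c (Ext.sec F d) = F.val c d := by
    change c • (1 : A) * F.val c d = F.val c d
    rw [smul_one, one_mul]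
  rw [mul_one, apply_eq_characterCochain_mul γ hG a b c, hκ] at h
  rw [dRight_three_apply]
  change (secCochain γ).1 ![b, c, d] * ((secCochain γ).1 ![a * b, c, d])⁻¹ *
    (secCochain γ).1 ![a, b * c, d] * ((characterCochain γ hG).1 ![a, b] (F.val c d) *
      ((secCochain γ).1 ![a, b, c * d] * ((secCochain γ).1 ![a, b, c])⁻¹))⁻¹ = 1 at h
  change (secCochain γ).1 ![b, c, d] * ((secCochain γ).1 ![a * b, c, d])⁻¹ *
    (secCochain γ).1 ![a, b * c, d] * ((secCochain γ).1 ![a, b, c * d])⁻¹ *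
      (secCochain γ).1 ![a, b, c] = (characterCochain γ hG).1 ![a, b] (F.val c d)
  rw [mul_inv_eq_one] at h
  rw [h]
  simp [mul_assoc]

theorem varphiHat_mul_deltaG_beta {F : ExtCocycle K A} (γ : Bi F 2 1)
    (hG : deltaG F 2 1 γ = 1) (hK : deltaK F 2 1 γ = 1) :
    varphiHat F ⟨characterCochain γ hG, characterCochain_mem_rightCocycles γ hG hK⟩ *
      deltaG F 2 0 (beta F (secCochain γ)) = γ := by
  refine Cochain.ext_two fun a b => Cochain.ext_one fun g => funext fun x => ?_
  rw [apply_eq_characterCochain_mul γ hG]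
  change (characterCochain γ hG).1 ![a, b] (kappa F x g) *
    (dLeft (mapAction F) 0 ((beta F (secCochain γ)).1 ![a, b])).1 ![g] x = _
  rw [dLeft_zero_apply]
  rfl

/-- The class of a total cocycle `(γ, η)` of filtration at least `2` is the class of an element of
`C^{2,1}` killed by both differentials: with `η = δ_K θ`, divide by `δ_Tot θ`. -/
theorem exists_single_of_mem_FilH {F : ExtCocycle K A} {c : TotH F 3} (hc : c ∈ FilH F 2 3) :
    ∃ (γ : Bi F 2 1) (hz : single F 2 1 γ ∈ TotZ F 3), deltaG F 2 1 γ = 1 ∧ deltaK F 2 1 γ = 1 ∧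
      c = QuotientGroup.mk (⟨single F 2 1 γ, hz⟩ : TotZ F 3) := by
  obtain ⟨z, rfl⟩ := hc
  obtain ⟨hz, hG, hGK, hK⟩ := ZInf_two_three F z
  obtain ⟨θ, hθ⟩ := exists_deltaK_two_zero_eq F _ hK
  have hG' : deltaG F 2 1 (z.1 2 1 * (deltaG F 2 0 θ)⁻¹) = 1 := by
    rw [map_mul, map_inv, hG, deltaG_deltaG_zero, inv_one, one_mul]
  have hK' : deltaK F 2 1 (z.1 2 1 * (deltaG F 2 0 θ)⁻¹) = 1 := by
    rw [map_mul, map_inv, hGK, deltaK_deltaG, hθ, mul_inv_cancel]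
  have hθT : deltaTot F (single F 2 0 θ) =
      single F 3 0 (z.1 3 0) * single F 2 1 (deltaG F 2 0 θ) := by
    rw [deltaTot_single, hθ]
    simp
  have hmul : single F 2 1 (z.1 2 1 * (deltaG F 2 0 θ)⁻¹) * deltaTot F (single F 2 0 θ) = z.1 := by
    rw [hθT, mul_comm (single F 3 0 _), ← mul_assoc, ← single_mul, inv_mul_cancel_right, ← hz]
  refine ⟨_, ⟨single_mem_Tot F 2 1 3 rfl _, ?_⟩, hG', hK', ?_⟩
  · change deltaTot F _ = 1
    rw [deltaTot_single, hG', hK', one_zpow]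
    unfold single
    simp only [Pi.mulSingle_one]
    exact one_mul 1
  · refine (QuotientGroup.eq.2 ?_).symm
    rw [Subgroup.mem_subgroupOf]
    refine ⟨single F 2 0 θ, single_mem_Tot F 2 0 2 rfl θ, ?_⟩
    change _ = (single F 2 1 _)⁻¹ * z.1
    exact eq_inv_mul_of_mul_eq hmul

theorem piStar_mem_FilH_of_mem_Omega {F : ExtCocycle K A} {c : GroupH (Ext F) 3}
    (hc : c ∈ Omega F) : piStar F 3 c ∈ FilH F 2 3 := by
  obtain ⟨d, hd, rfl⟩ := hc
  exact mem_FilH_succ F 1 3 _ hd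

end LHS

theorem mainTheorem4 {K A : Type*} [Group K] [Finite K] [CommGroup A] [Finite A]
    [MulDistribMulAction K A] (F : LHS.ExtCocycle K A)
    (c : LHS.GroupH (LHS.Ext F) 3) (hc : c ∈ LHS.Omega F) :
    ∃ (Fhat : LHS.DualCocycle K A) (ε : LHS.Cochain K ℂˣ 3),
      LHS.dRight (1 : Kᵐᵒᵖ →* Monoid.End ℂˣ) 3 ε = LHS.wedge Fhat F ∧
      ∃ hz : LHS.single F 2 1 (LHS.varphiHat F Fhat * LHS.deltaG F 2 0 (LHS.beta F ε)) ∈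
          LHS.TotZ F 3,
        LHS.piStar F 3 c =
          QuotientGroup.mk
            (⟨LHS.single F 2 1 (LHS.varphiHat F Fhat * LHS.deltaG F 2 0 (LHS.beta F ε)), hz⟩ :
              LHS.TotZ F 3) := by
  obtain ⟨γ, hz, hG, hK, h⟩ :=
    LHS.exists_single_of_mem_FilH (LHS.piStar_mem_FilH_of_mem_Omega hc)
  refine ⟨⟨LHS.characterCochain γ hG, LHS.characterCochain_mem_rightCocycles γ hG hK⟩,
    LHS.secCochain γ, LHS.dRight_secCochain γ hG hK, ?_⟩
  rw [LHS.varphiHat_mul_deltaG_beta γ hG hK]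
  exact ⟨hz, h⟩
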